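/- Let $q\in\mathbb{C}$ be a root of unity, and let $p$ be the smallest positive integer with $q^p=1$; assume $p\neq 1,2$ (that is, $q\neq\pm1$). Fix a square root $q^{1/2}$ of $q$, and let $U_q(\mathrm{so}_3)$ be the unital associative complex algebra generated by $I_1,I_2,I_3$ subject to the defining relations $$q^{1/2}I_1I_2-q^{-1/2}I_2I_1=I_3,\qquad q^{1/2}I_2I_3-q^{-1/2}I_3I_2=I_1,\qquad q^{1/2}I_3I_1-q^{-1/2}I_1I_3=I_2 .$$ Then every irreducible representation of $U_q(\mathrm{so}_3)$ is finite-dimensional: if $V$ is a complex vector space and $T:U_q(\mathrm{so}_3)\to\mathrm{End}_{\mathbb{C}}(V)$ is a homomorphism of unital algebras such that $V\neq 0$ and the only $T$-invariant linear subspaces of $V$ are $0$ and $V$, then $\dim_{\mathbb{C}}V<\infty$. -/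

import Mathlib

/-- The defining relations of `U_q(so₃)` on the free complex algebra with generators
`x₀, x₁, x₂` (standing for `I₁, I₂, I₃`), where `s` is a chosen square root `q^{1/2}` of `q`:
`q^{1/2} I₁ I₂ - q^{-1/2} I₂ I₁ = I₃` and its two cyclic permutations. -/
inductive UqSo3Rel (s : ℂ) : FreeAlgebra ℂ (Fin 3) → FreeAlgebra ℂ (Fin 3) → Prop
  | rel₁₂ : UqSo3Rel s
      (s • (FreeAlgebra.ι ℂ 0 * FreeAlgebra.ι ℂ 1) - s⁻¹ • (FreeAlgebra.ι ℂ 1 * FreeAlgebra.ι ℂ 0))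
      (FreeAlgebra.ι ℂ 2)
  | rel₂₃ : UqSo3Rel s
      (s • (FreeAlgebra.ι ℂ 1 * FreeAlgebra.ι ℂ 2) - s⁻¹ • (FreeAlgebra.ι ℂ 2 * FreeAlgebra.ι ℂ 1))
      (FreeAlgebra.ι ℂ 0)
  | rel₃₁ : UqSo3Rel s
      (s • (FreeAlgebra.ι ℂ 2 * FreeAlgebra.ι ℂ 0) - s⁻¹ • (FreeAlgebra.ι ℂ 0 * FreeAlgebra.ι ℂ 2))
      (FreeAlgebra.ι ℂ 1)

/-- The algebra `U_q(so₃)` with `q = s ^ 2` and `q^{1/2} = s`: the unital associative complex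
algebra generated by `I₁, I₂, I₃` subject to the relations `UqSo3Rel s`. -/
abbrev UqSo3 (s : ℂ) : Type := RingQuot (UqSo3Rel s)

/-!
Finite-dimensionality follows from the algebra `U_q(so₃)` being finite over its centre when `q` is
a root of unity. Write `q = s ^ 2`, and let `C n` be the Chebyshev polynomial with
`C n (t + t⁻¹) = t ^ n + t⁻¹ ^ n`. Conjugating past `I₂` and `I₃` shifts the "eigenvalue"
`t + t⁻¹` of `(q - q⁻¹) I₁` to `q t + q⁻¹ t⁻¹` or `q⁻¹ t + q t⁻¹`, so `C p` of it changes `t ^ p`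
into `q ^ (± p) t ^ p = t ^ p`. Thus `C p ((q - q⁻¹) I₁)` is central
(`IsUqSo3Triple.commute_aeval_C`), and by cyclic symmetry the same holds for `I₂` and `I₃`.

On an irreducible `V`, the ordered monomials `I₁ ^ a I₂ ^ b I₃ ^ c` applied to a nonzero vector span
(`IsUqSo3Triple.mem_span_monomials`), so `V` has countable dimension. Since `ℂ` is uncountable,
Schur's lemma in Dixmier's form (`Representation.IsIrreducible.eq_algebraMap_of_commute`) makes the
central elements act by scalars. As `q ≠ ± 1`, the factor `q - q⁻¹` is nonzero and each `Iⱼ` acts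
as an algebraic operator, so boundedly many powers of each suffice and the image of the algebra in
`End V` is finite-dimensional (`IsUqSo3Triple.fg_adjoin`); hence so is `V`.
-/

open Polynomial

universe u v

/-! ### Schur's lemma in small dimension -/

section Spectrum

variable {K : Type u} {V : Type v} [Field K] [AddCommGroup V] [Module K V]

theorem isUnit_aeval_of_spectrum_eq_empty {A : Type*} [Ring A] [Algebra K A] [IsAlgClosed K]
    {a : A} (ha : spectrum K a = ∅) {f : K[X]} (hf : f ≠ 0) : IsUnit (aeval a f) := by
  have hprod := (IsAlgClosed.splits f).eq_prod_roots
  rw [hprod, map_mul, Polynomial.aeval_C]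
  refine IsUnit.mul ?_ ?_
  · exact (IsUnit.mk0 _ (leadingCoeff_ne_zero.mpr hf)).map (algebraMap K A)
  · by_contra h
    obtain ⟨k, hk, -⟩ := spectrum.exists_mem_of_not_isUnit_aeval_prod h
    simp [ha] at hk

/-- If `z` has empty spectrum, the vectors `w c = (z - c)⁻¹ v` with `c` running over the whole field
are linearly independent: clearing denominators in a linear relation gives `f z v = 0` for a
polynomial `f`, and a nonzero `f` would make `f z` invertible. -/
theorem linearIndependent_resolvent [IsAlgClosed K] {z : Module.End K V}
    (hz : spectrum K z = ∅) {v : V} (hv : v ≠ 0) (w : K → V)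
    (hw : ∀ c, aeval z (X - C c) (w c) = v) : LinearIndependent K w := by
  classical
  rw [linearIndependent_iff']
  intro t g hg i hi
  set f : K[X] := ∑ j ∈ t, C (g j) * ∏ k ∈ t.erase j, (X - C k) with hf
  have hfv : aeval z f v = 0 := by
    have key : aeval z (∏ k ∈ t, (X - C k)) (∑ j ∈ t, g j • w j) = aeval z f v := by
      rw [hf, map_sum, map_sum, LinearMap.sum_apply]
      refine Finset.sum_congr rfl fun j hj => ?_
      rw [← Finset.prod_erase_mul t _ hj, map_mul, map_smul, Module.End.mul_apply, hw, map_mul,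
        Polynomial.aeval_C, Module.End.mul_apply, Module.algebraMap_end_apply]
    rw [← key, hg, map_zero]
  have hf0 : f = 0 := by
    by_contra h
    have hu := (Module.End.isUnit_iff _).mp (isUnit_aeval_of_spectrum_eq_empty hz h)
    exact hv (hu.1 (by rw [hfv, map_zero]))
  -- Only the `i`-th summand of `f` survives evaluation at `i`.
  have hev : f.eval i = g i * ∏ k ∈ t.erase i, (i - k) := by
    rw [hf, eval_finsetSum, Finset.sum_eq_single_of_mem i hi]
    · simp [eval_prod]
    · intro j _ hji
      rw [eval_mul, eval_prod, Finset.prod_eq_zero (Finset.mem_erase.mpr ⟨hji.symm, hi⟩), mul_zero]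
      simp
  rw [hf0, eval_zero] at hev
  refine (mul_eq_zero.mp hev.symm).resolve_right (Finset.prod_ne_zero_iff.mpr fun k hk => ?_)
  exact sub_ne_zero.mpr (Finset.ne_of_mem_erase hk).symm

/-- Over an algebraically closed field `K`, every endomorphism of a nonzero space of dimension less
than the cardinality of `K` has a spectral value. -/
theorem spectrum_nonempty_of_rank_lt [IsAlgClosed K] [Nontrivial V]
    (h : Cardinal.lift.{u} (Module.rank K V) < Cardinal.lift.{v} (Cardinal.mk K))
    (z : Module.End K V) : (spectrum K z).Nonempty := by
  rw [Set.nonempty_iff_ne_empty]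
  intro hz
  obtain ⟨v, hv⟩ := exists_ne (0 : V)
  have hsurj (c : K) : ∃ w, aeval z (X - C c) w = v :=
    ((Module.End.isUnit_iff _).mp
      (isUnit_aeval_of_spectrum_eq_empty hz (X_sub_C_ne_zero c))).2 v
  choose w hw using hsurj
  exact absurd (linearIndependent_resolvent hz hv w hw).cardinal_lift_le_rank (not_le.mpr h)

theorem Representation.IsIrreducible.nontrivial {G : Type*} [Monoid G]
    {ρ : Representation K G V} (hρ : ρ.IsIrreducible) : Nontrivial V := by
  obtain ⟨a, b, hab⟩ := hρ.toNontrivial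
  by_contra hV
  rw [not_nontrivial_iff_subsingleton] at hV
  exact hab (Subrepresentation.toSubmodule_injective (Subsingleton.elim _ _))

/-- Schur's lemma in Dixmier's form: finite-dimensionality is replaced by the dimension being less
than the cardinality of the algebraically closed field. -/
theorem Representation.IsIrreducible.eq_algebraMap_of_commute {G : Type*} [Monoid G]
    [IsAlgClosed K] {ρ : Representation K G V} (hρ : ρ.IsIrreducible)
    (h : Cardinal.lift.{u} (Module.rank K V) < Cardinal.lift.{v} (Cardinal.mk K))
    {z : Module.End K V} (hz : ∀ g, Commute z (ρ g)) :
    ∃ c : K, z = algebraMap K (Module.End K V) c := by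
  have := hρ.nontrivial
  obtain ⟨c, hc⟩ := spectrum_nonempty_of_rank_lt h z
  refine ⟨c, ?_⟩
  let f : IntertwiningMap ρ ρ := ⟨algebraMap K _ c - z, fun g =>
    ((Algebra.commute_algebraMap_left c (ρ g)).sub_left (hz g)).eq⟩
  rcases Representation.IsIrreducible.bijective_or_eq_zero f with hf | hf
  · exact absurd ((Module.End.isUnit_iff _).mpr hf) hc
  · exact (sub_eq_zero.mp (congrArg IntertwiningMap.toLinearMap hf)).symm

end Spectrum

/-! ### Triples satisfying the relations of `U_q(so₃)` -/

section Triple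

variable {K A : Type*} [Field K] [Ring A] [Algebra K A]

/-- Three elements `x, y, z` of an algebra that satisfy the defining relations of `U_q(so₃)` with
`q = s ^ 2`. The relations are invariant under the cyclic rotation `rotate`, which is what lets
every statement about `x` be transferred to `y` and `z`. -/
structure IsUqSo3Triple (s : K) (x y z : A) : Prop where
  rel₁₂ : s • (x * y) - s⁻¹ • (y * x) = z
  rel₂₃ : s • (y * z) - s⁻¹ • (z * y) = x
  rel₃₁ : s • (z * x) - s⁻¹ • (x * z) = y

namespace IsUqSo3Triple

variable {s : K} {x y z : A}

theorem rotate (h : IsUqSo3Triple s x y z) : IsUqSo3Triple s y z x :=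
  ⟨h.rel₂₃, h.rel₃₁, h.rel₁₂⟩

theorem mul_comm₂₁ (h : IsUqSo3Triple s x y z) (hs : s ≠ 0) :
    y * x = s ^ 2 • (x * y) - s • z := by
  rw [← h.rel₁₂]
  match_scalars <;> field_simp; ring

theorem mul_comm₃₁ (h : IsUqSo3Triple s x y z) (hs : s ≠ 0) :
    z * x = s⁻¹ ^ 2 • (x * z) + s⁻¹ • y := by
  rw [← h.rel₃₁]
  match_scalars <;> field_simp; ring

theorem mul_comm₃₂ (h : IsUqSo3Triple s x y z) (hs : s ≠ 0) :
    z * y = s ^ 2 • (y * z) - s • x := h.rotate.mul_comm₂₁ hs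

/-- How a Chebyshev polynomial in `a = (q - q⁻¹) x` moves past `y` and `z`, where `q = s ^ 2`.
On pairs `(y, z)`, left multiplication by `a` is right multiplication by a `2 × 2` matrix with
entries in `K[a]`; the two identities spell out the value of `C n` on that matrix, whose
off-diagonal entries carry the factor `q ^ n - q⁻¹ ^ n`. -/
theorem aeval_C_mul (h : IsUqSo3Triple s x y z) (hs : s ≠ 0) {a : A}
    (ha : a = (s ^ 2 - s⁻¹ ^ 2) • x) (n : ℕ) :
    aeval a (Chebyshev.C K n) * y =
        y * ((s⁻¹ ^ 2) ^ n • aeval a (Chebyshev.S K n) -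
          (s ^ 2) ^ n • aeval a (Chebyshev.S K (n - 2))) +
        (s⁻¹ * ((s ^ 2) ^ n - (s⁻¹ ^ 2) ^ n)) • (z * aeval a (Chebyshev.S K (n - 1))) ∧
    aeval a (Chebyshev.C K n) * z =
        z * ((s ^ 2) ^ n • aeval a (Chebyshev.S K n) -
          (s⁻¹ ^ 2) ^ n • aeval a (Chebyshev.S K (n - 2))) -
        (s * ((s ^ 2) ^ n - (s⁻¹ ^ 2) ^ n)) • (y * aeval a (Chebyshev.S K (n - 1))) := by
  have hay : a * y = s⁻¹ ^ 2 • (y * a) + (s⁻¹ * (s ^ 2 - s⁻¹ ^ 2)) • z := by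
    rw [ha, mul_smul_comm, h.mul_comm₂₁ hs, smul_mul_assoc]
    match_scalars <;> field_simp; ring
  have haz : a * z = s ^ 2 • (z * a) - (s * (s ^ 2 - s⁻¹ ^ 2)) • y := by
    rw [ha, mul_smul_comm, h.mul_comm₃₁ hs, smul_mul_assoc]
    match_scalars <;> field_simp; ring
  have hS (m : ℤ) : a * aeval a (Chebyshev.S K m) =
      aeval a (Chebyshev.S K (m + 1)) + aeval a (Chebyshev.S K (m - 1)) := by
    rw [Chebyshev.S_add_one, ← map_add, sub_add_cancel, map_mul, aeval_X]
  induction n using Nat.twoStepInduction with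
  | zero =>
    simp only [Nat.cast_zero, Chebyshev.C_zero, Chebyshev.S_zero, zero_sub, Chebyshev.S_neg_one,
      Chebyshev.S_neg_two, pow_zero, map_zero, map_one, map_neg, map_ofNat, mul_zero, sub_self,
      smul_zero, one_smul]
    constructor <;> noncomm_ring
  | one =>
    have h1 : (1 : ℤ) - 2 = -1 := by norm_num
    simp only [Nat.cast_one, h1, Chebyshev.C_one, Chebyshev.S_one, Chebyshev.S_zero,
      Chebyshev.S_neg_one, sub_self, pow_one, map_zero, map_one, aeval_X, hay, haz, smul_zero,
      sub_zero, mul_one, mul_smul_comm]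
    exact ⟨trivial, trivial⟩
  | more n ih0 ih1 =>
    obtain ⟨ihy0, ihz0⟩ := ih0
    obtain ⟨ihy1, ihz1⟩ := ih1
    have e1 : ((n + 1 : ℕ) : ℤ) = n + 1 := by push_cast; ring
    have e2 : ((n + 2 : ℕ) : ℤ) = n + 2 := by push_cast; ring
    have e3 : (n : ℤ) + 1 - 2 = n - 1 := by ring
    have e4 : (n : ℤ) + 1 - 1 = n := by ring
    have e5 : (n : ℤ) + 2 - 2 = n := by ring
    have e6 : (n : ℤ) + 2 - 1 = n + 1 := by ring
    have e7 : (n : ℤ) + 1 + 1 = n + 2 := by ring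
    have e8 : (n : ℤ) - 1 + 1 = n := by ring
    have e9 : (n : ℤ) - 1 - 1 = n - 2 := by ring
    have hS0 := hS n
    have hS1 := hS (n + 1)
    have hS2 := hS (n - 1)
    rw [e1, e3, e4] at ihy1 ihz1
    rw [e4, e7] at hS1
    rw [e8, e9] at hS2
    rw [e2, e5, e6, Chebyshev.C_add_two, map_sub, map_mul, aeval_X, sub_mul, sub_mul,
      mul_assoc, mul_assoc, ihy0, ihy1, ihz0, ihz1]
    -- Both sides become combinations of `y * S k` and `z * S k`: the letter `a` is first moved
    -- to the right of `y` and `z`, and then absorbed into the `S k`.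
    simp only [mul_sub, mul_add, mul_smul_comm, ← mul_assoc, hay, haz]
    simp only [add_mul, sub_mul, smul_mul_assoc, mul_assoc, hS0, hS1, hS2]
    simp only [mul_add]
    constructor <;> match_scalars <;> (try simp only [inv_pow]) <;> field_simp <;> ring

/-- If `q = s ^ 2` satisfies `q ^ p = 1`, then `C p` evaluated at `(q - q⁻¹) x` is central in the
algebra generated by `x, y, z`: the mixed terms in `aeval_C_mul` vanish and the diagonal ones are
`S p - S (p - 2) = C p`. -/
theorem commute_aeval_C (h : IsUqSo3Triple s x y z) (hs : s ≠ 0) {p : ℕ} (hp : (s ^ 2) ^ p = 1)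
    {a : A} (ha : a = (s ^ 2 - s⁻¹ ^ 2) • x) :
    Commute (aeval a (Chebyshev.C K p)) x ∧ Commute (aeval a (Chebyshev.C K p)) y ∧
      Commute (aeval a (Chebyshev.C K p)) z := by
  have hp' : (s⁻¹ ^ 2) ^ p = 1 := by rw [inv_pow, inv_pow, hp, inv_one]
  have hC : Chebyshev.C K p = Chebyshev.S K p - Chebyshev.S K (p - 2) := by
    rw [Chebyshev.C_eq_S_sub_X_mul_S]
    linear_combination Chebyshev.S_eq K p
  obtain ⟨hy, hz⟩ := h.aeval_C_mul hs ha p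
  simp only [hp, hp', sub_self, mul_zero, zero_smul, add_zero, sub_zero, one_smul, ← map_sub,
    ← hC] at hy hz
  have hxa : Commute x a := ha ▸ (Commute.refl x).smul_right _
  exact ⟨(Algebra.commute_of_mem_adjoin_singleton_of_commute
    (aeval_mem_adjoin_singleton K a) hxa).symm, hy, hz⟩

/-- The spanning half of the Poincaré–Birkhoff–Witt theorem. -/
theorem mem_span_monomials (h : IsUqSo3Triple s x y z) (hs : s ≠ 0) {u : A}
    (hu : u ∈ Algebra.adjoin K {x, y, z}) :
    u ∈ Submodule.span K (Set.range fun m : ℕ × ℕ × ℕ => x ^ m.1 * y ^ m.2.1 * z ^ m.2.2) := by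
  -- The ordered monomials of total degree at most `n`.
  let G (n : ℕ) : Submodule K A := Submodule.span K
    {u | ∃ a b c, a + b + c ≤ n ∧ x ^ a * y ^ b * z ^ c = u}
  have hGmem {n a b c : ℕ} (hn : a + b + c ≤ n) : x ^ a * y ^ b * z ^ c ∈ G n :=
    Submodule.subset_span ⟨a, b, c, hn, rfl⟩
  have hmono {m n : ℕ} (hmn : m ≤ n) : G m ≤ G n :=
    Submodule.span_mono fun _ ⟨a, b, c, hn, e⟩ => ⟨a, b, c, hn.trans hmn, e⟩
  have hmul {g : A} {n k : ℕ}
      (hg : ∀ a b c, a + b + c ≤ n → g * (x ^ a * y ^ b * z ^ c) ∈ G k) {u : A} (hu : u ∈ G n) :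
      g * u ∈ G k := by
    refine (Submodule.span_le (p := (G k).comap (LinearMap.mulLeft K g))).mpr ?_ hu
    rintro _ ⟨a, b, c, hn, rfl⟩
    exact hg a b c hn
  have hx {n : ℕ} {u : A} (hu : u ∈ G n) : x * u ∈ G (n + 1) := by
    refine hmul (fun a b c hn => ?_) hu
    rw [← mul_assoc, ← mul_assoc, ← pow_succ']
    exact hGmem (by omega)
  -- Reordering a product with `y` or `z` produces lower-order terms in the other two letters, so
  -- the two bounds are proved together, by strong induction on the total degree.
  have hyz (n : ℕ) : (∀ u ∈ G n, y * u ∈ G (n + 1)) ∧ ∀ u ∈ G n, z * u ∈ G (n + 1) := by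
    induction n using Nat.strong_induction_on with
    | _ n ih =>
      have hy (u) (hu : u ∈ G n) : y * u ∈ G (n + 1) := by
        refine hmul (fun a b c hn => ?_) hu
        obtain _ | a := a
        · rw [pow_zero, one_mul, ← mul_assoc, ← pow_succ', ← one_mul (y ^ _), ← pow_zero x]
          exact hGmem (by omega)
        · obtain ⟨n, rfl⟩ : ∃ k, n = k + 1 := ⟨n - 1, by omega⟩
          have hm : x ^ a * y ^ b * z ^ c ∈ G n := hGmem (by omega)
          have e : y * (x ^ (a + 1) * y ^ b * z ^ c) =
              s ^ 2 • (x * (y * (x ^ a * y ^ b * z ^ c))) - s • (z * (x ^ a * y ^ b * z ^ c)) := by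
            have := congrArg (· * (x ^ a * y ^ b * z ^ c)) (h.mul_comm₂₁ hs)
            simpa only [pow_succ' x, sub_mul, smul_mul_assoc, mul_assoc] using this
          rw [e]
          exact sub_mem (Submodule.smul_mem _ _ (hx ((ih n (by omega)).1 _ hm)))
            (Submodule.smul_mem _ _ (hmono (by omega) ((ih n (by omega)).2 _ hm)))
      refine ⟨hy, fun u hu => hmul (fun a b c hn => ?_) hu⟩
      obtain _ | a := a
      · obtain _ | b := b
        · have := hGmem (n := n + 1) (a := 0) (b := 0) (c := c + 1) (by omega)
          simpa only [pow_succ' z, pow_zero, one_mul] using this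
        · obtain ⟨n, rfl⟩ : ∃ k, n = k + 1 := ⟨n - 1, by omega⟩
          have hm : x ^ 0 * y ^ b * z ^ c ∈ G n := hGmem (by omega)
          have e : z * (x ^ 0 * y ^ (b + 1) * z ^ c) =
              s ^ 2 • (y * (z * (x ^ 0 * y ^ b * z ^ c))) - s • (x * (x ^ 0 * y ^ b * z ^ c)) := by
            have := congrArg (· * (x ^ 0 * y ^ b * z ^ c)) (h.mul_comm₃₂ hs)
            simpa only [pow_succ' y, sub_mul, smul_mul_assoc, mul_assoc, pow_zero, one_mul]
              using this
          rw [e]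
          exact sub_mem (Submodule.smul_mem _ _ (hy _ ((ih n (by omega)).2 _ hm)))
            (Submodule.smul_mem _ _ (hmono (by omega) (hx hm)))
      · obtain ⟨n, rfl⟩ : ∃ k, n = k + 1 := ⟨n - 1, by omega⟩
        have hm : x ^ a * y ^ b * z ^ c ∈ G n := hGmem (by omega)
        have e : z * (x ^ (a + 1) * y ^ b * z ^ c) =
            s⁻¹ ^ 2 • (x * (z * (x ^ a * y ^ b * z ^ c))) +
              s⁻¹ • (y * (x ^ a * y ^ b * z ^ c)) := by
          have := congrArg (· * (x ^ a * y ^ b * z ^ c)) (h.mul_comm₃₁ hs)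
          simpa only [pow_succ' x, add_mul, smul_mul_assoc, mul_assoc] using this
        rw [e]
        exact add_mem (Submodule.smul_mem _ _ (hx ((ih n (by omega)).2 _ hm)))
          (Submodule.smul_mem _ _ (hmono (by omega) ((ih n (by omega)).1 _ hm)))
  have hG (u : A) (hu : u ∈ Algebra.adjoin K {x, y, z}) : ∀ n, ∀ m ∈ G n, ∃ k, u * m ∈ G k := by
    induction hu using Algebra.adjoin_induction with
    | mem u hu =>
      intro n m hm
      rcases hu with rfl | rfl | rfl
      exacts [⟨n + 1, hx hm⟩, ⟨n + 1, (hyz n).1 m hm⟩, ⟨n + 1, (hyz n).2 m hm⟩]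
    | algebraMap r =>
      intro n m hm
      exact ⟨n, by rw [← Algebra.smul_def]; exact Submodule.smul_mem _ _ hm⟩
    | add u v _ _ hu hv =>
      intro n m hm
      obtain ⟨k, hk⟩ := hu n m hm
      obtain ⟨l, hl⟩ := hv n m hm
      exact ⟨max k l, by
        rw [add_mul]; exact add_mem (hmono (le_max_left _ _) hk) (hmono (le_max_right _ _) hl)⟩
    | mul u v _ _ hu hv =>
      intro n m hm
      obtain ⟨k, hk⟩ := hv n m hm
      obtain ⟨l, hl⟩ := hu k _ hk
      exact ⟨l, by rwa [mul_assoc]⟩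
  obtain ⟨k, hk⟩ := hG u hu 0 1 (by simpa using hGmem (n := 0) (a := 0) (b := 0) (c := 0) le_rfl)
  rw [mul_one] at hk
  refine Submodule.span_mono ?_ hk
  rintro _ ⟨a, b, c, -, rfl⟩
  exact ⟨(a, b, c), rfl⟩

theorem fg_adjoin (h : IsUqSo3Triple s x y z) (hs : s ≠ 0) (hx : IsIntegral K x)
    (hy : IsIntegral K y) (hz : IsIntegral K z) :
    (Subalgebra.toSubmodule (Algebra.adjoin K {x, y, z})).FG := by
  refine Submodule.FG.of_le
    ((hx.fg_adjoin_singleton.mul hy.fg_adjoin_singleton).mul hz.fg_adjoin_singleton) fun u hu => ?_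
  refine Submodule.span_le.mpr ?_ (h.mem_span_monomials hs hu)
  rintro _ ⟨⟨a, b, c⟩, rfl⟩
  exact Submodule.mul_mem_mul (Submodule.mul_mem_mul
    (pow_mem (Algebra.self_mem_adjoin_singleton K x) a)
    (pow_mem (Algebra.self_mem_adjoin_singleton K y) b))
    (pow_mem (Algebra.self_mem_adjoin_singleton K z) c)

end IsUqSo3Triple

end Triple

/-! ### Algebraicity from Chebyshev polynomials -/

theorem Polynomial.Chebyshev.natDegree_C {K : Type*} [Field K] [NeZero (2 : K)] (n : ℕ) :
    (Chebyshev.C K n).natDegree = n := by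
  have h2 : (2 : K) ≠ 0 := NeZero.ne 2
  have h := congrArg natDegree (Chebyshev.C_comp_two_mul_X K n)
  rw [← map_ofNat Polynomial.C 2, natDegree_comp, natDegree_C_mul_X _ h2, mul_one,
    natDegree_C_mul h2, Chebyshev.natDegree_T] at h
  simpa using h

theorem isIntegral_of_aeval_smul_eq_algebraMap {K A : Type*} [Field K] [Ring A] [Algebra K A]
    {f : K[X]} (hf : f.natDegree ≠ 0) {w : K} (hw : w ≠ 0) {x : A} {c : K}
    (h : aeval (w • x) f = algebraMap K A c) : IsIntegral K x := by
  have hwx : IsIntegral K (w • x) := by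
    refine IsAlgebraic.isIntegral ⟨f - Polynomial.C c, fun h0 => hf ?_, ?_⟩
    · rw [sub_eq_zero.mp h0, Polynomial.natDegree_C]
    · rw [map_sub, h, Polynomial.aeval_C, sub_self]
  simpa [smul_smul, inv_mul_cancel₀ hw] using hwx.smul w⁻¹

/-! ### Irreducible representations -/

theorem theorem4 (q s : ℂ) (hs : s ^ 2 = q)
    (p : ℕ) (hp : 0 < p) (hq : IsPrimitiveRoot q p) (hp1 : p ≠ 1) (hp2 : p ≠ 2)
    {V : Type*} [AddCommGroup V] [Module ℂ V]
    (T : UqSo3 s →ₐ[ℂ] Module.End ℂ V)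
    (hT : Representation.IsIrreducible (T : UqSo3 s →* Module.End ℂ V)) :
    FiniteDimensional ℂ V := by
  have hs0 : s ≠ 0 := by
    rintro rfl
    exact hq.ne_zero hp.ne' (by rw [← hs]; simp)
  have hw : s ^ 2 - s⁻¹ ^ 2 ≠ 0 := by
    intro h
    have h4 : q ^ 2 = 1 := by
      rw [← hs]
      field_simp at h
      linear_combination h
    have := Nat.le_of_dvd two_pos (hq.dvd_of_pow_eq_one 2 h4)
    omega
  have hqp : (s ^ 2) ^ p = 1 := by rw [hs, hq.pow_eq_one]
  let φ : FreeAlgebra ℂ (Fin 3) →ₐ[ℂ] Module.End ℂ V :=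
    T.comp (RingQuot.mkAlgHom ℂ (UqSo3Rel s))
  set x := φ (FreeAlgebra.ι ℂ 0) with hx
  set y := φ (FreeAlgebra.ι ℂ 1) with hy
  set z := φ (FreeAlgebra.ι ℂ 2) with hz
  have hφ {a b : FreeAlgebra ℂ (Fin 3)} (hab : UqSo3Rel s a b) : φ a = φ b :=
    congrArg T (RingQuot.mkAlgHom_rel ℂ hab)
  have htriple : IsUqSo3Triple s x y z :=
    ⟨by simpa using hφ .rel₁₂, by simpa using hφ .rel₂₃, by simpa using hφ .rel₃₁⟩
  have hrange (u : UqSo3 s) : T u ∈ Algebra.adjoin ℂ {x, y, z} := by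
    obtain ⟨u, rfl⟩ := RingQuot.mkAlgHom_surjective ℂ (UqSo3Rel s) u
    change φ u ∈ _
    induction u using FreeAlgebra.induction with
    | grade0 r => rw [AlgHom.commutes]; exact Subalgebra.algebraMap_mem _ r
    | grade1 i => fin_cases i <;> exact Algebra.subset_adjoin (by simp [hx, hy, hz])
    | mul a b ha hb => rw [map_mul]; exact mul_mem ha hb
    | add a b ha hb => rw [map_add]; exact add_mem ha hb
  have := hT.nontrivial
  obtain ⟨v, hv0⟩ := exists_ne (0 : V)
  -- A nonzero vector is cyclic: its orbit is a nonzero subrepresentation.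
  have hv (v' : V) : ∃ u, T u v = v' := by
    let W : Subrepresentation (T : UqSo3 s →* Module.End ℂ V) :=
      ⟨(LinearMap.applyₗ v ∘ₗ T.toLinearMap).range, by
        rintro g _ ⟨u, rfl⟩
        exact ⟨g * u, by simp⟩⟩
    have hvW : v ∈ W.toSubmodule := ⟨1, by simp⟩
    have hW : W = ⊤ := by
      refine (hT.eq_bot_or_eq_top W).resolve_left fun h => hv0 ?_
      rw [h] at hvW
      exact hvW
    have hv' : v' ∈ W.toSubmodule := hW ▸ Submodule.mem_top
    exact hv'
  have hrank : Module.rank ℂ V ≤ Cardinal.aleph0 := by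
    let m (i : ℕ × ℕ × ℕ) : Module.End ℂ V := x ^ i.1 * y ^ i.2.1 * z ^ i.2.2
    have htop : Submodule.span ℂ (Set.range fun i => m i v) = ⊤ := by
      refine eq_top_iff.mpr fun v' _ => ?_
      obtain ⟨u, rfl⟩ := hv v'
      have := Submodule.mem_map_of_mem (f := LinearMap.applyₗ v)
        (htriple.mem_span_monomials hs0 (hrange u))
      rwa [Submodule.map_span, ← Set.range_comp] at this
    rw [← rank_top, ← htop]
    exact (rank_span_le _).trans (Set.countable_range _).le_aleph0
  have hlt : Cardinal.lift.{0} (Module.rank ℂ V) < Cardinal.lift (Cardinal.mk ℂ) := by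
    rw [Cardinal.lift_uzero, Cardinal.mk_complex, Cardinal.lift_continuum]
    exact hrank.trans_lt Cardinal.aleph0_lt_continuum
  have hint {a b c : Module.End ℂ V} (h : IsUqSo3Triple s a b c)
      (habc : ({x, y, z} : Set (Module.End ℂ V)) ⊆ {a, b, c}) : IsIntegral ℂ a := by
    obtain ⟨ha, hb, hc⟩ := h.commute_aeval_C hs0 hqp rfl
    obtain ⟨k, hk⟩ := hT.eq_algebraMap_of_commute hlt
      (z := aeval ((s ^ 2 - s⁻¹ ^ 2) • a) (Chebyshev.C ℂ p)) fun u => by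
        refine Algebra.commute_of_mem_adjoin_of_forall_mem_commute
          (Algebra.adjoin_mono habc (hrange u)) ?_
        rintro _ (rfl | rfl | rfl)
        exacts [ha, hb, hc]
    exact isIntegral_of_aeval_smul_eq_algebraMap
      (by rw [Chebyshev.natDegree_C]; exact hp.ne') hw hk
  have hfg := htriple.fg_adjoin hs0 (hint htriple subset_rfl)
    (hint htriple.rotate (by intro; simp; tauto))
    (hint htriple.rotate.rotate (by intro; simp; tauto))
  refine ⟨(hfg.map (LinearMap.applyₗ v)).of_le fun v' _ => ?_⟩
  obtain ⟨u, rfl⟩ := hv v'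
  exact Submodule.mem_map_of_mem (f := LinearMap.applyₗ v) (hrange u)
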